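/- Let $d\ge 2$, let $M_d$ be the algebra of complex $d\times d$ matrices, and put $a=(d^2-1)^{-1/2}$, $b=(d^2-1)^{-1}$ and, for $\lambda\in[0,d]$, $c_\lambda=\frac{\lambda d-2}{d^2-1}$ and $$E_\lambda=\Big\{(s,t)\in\mathbb R^2:\ \frac{t^2}{a^2}+\frac{(s-c_\lambda)^2}{b^2}\le\lambda^2\Big\}.$$ A *universal $1\to2$ cloner with singlet fractions* $(p_1,p_2)\in\mathbb R^2$ is a completely positive trace-preserving linear map $T:M_d\to M_d\otimes M_d$ whose marginals $T_1=\mathrm{Tr}_2\circ T$ and $T_2=\mathrm{Tr}_1\circ T$ satisfy $T_i(\rho)=p_i\rho+(1-p_i)\frac{I_d}{d}$ for all density matrices $\rho$ and $i=1,2$. Its fidelities are the numbers $f_i=\langle\psi|T_i(|\psi\rangle\langle\psi|)|\psi\rangle$, which do not depend on the unit vector $\psi\in\mathbb C^d$. 1. The set of pairs $(p_1,p_2)$ of singlet fractions of universal $1\to2$ cloners is the set of all $(p_1,p_2)$ with $(p_1+p_2,\,p_1-p_2)\in\bigcup_{\lambda\in[0,d]}E_\lambda$. 2. The set of pairs $(f_1,f_2)$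 of fidelities of universal $1\to2$ cloners is the set of all $(f_1,f_2)$ with $\left(\frac{d(f_1+f_2)-2}{d-1},\,\frac{d(f_1-f_2)}{d-1}\right)\in\bigcup_{\lambda\in[0,d]}E_\lambda$. 3. The optimal cloners correspond to $\lambda=d$. Precisely, let $w=(w_1,w_2)\in[0,1]^2$ with $w\ne(0,0)$, and call a completely positive trace-preserving map $T:M_d\to M_d\otimes M_d$ *optimal for $w$* if it maximizes $F_w(T)=\sum_{i=1}^2 w_i\inf_{\|\psi\|=1}\langle\psi|T_i(|\psi\rangle\langle\psi|)|\psi\rangle$ among all such maps. Then some universal cloner is optimal for $w$. A universal cloner with singlet fractions $(p_1,p_2)$ is optimal for $w$ if and only if $(p_1+p_2,p_1-p_2)\in E_d$ and $w_1q_1+w_2q_2\le w_1p_1+w_2p_2$ for all $(q_1,q_2)$ with $(q_1+q_2,q_1-q_2)\in E_d$. Moreover, in that case $\lambda=d$ is the only $\lambda\in[0,d]$ with $(p_1+p_2,p_1-p_2)\in E_\lambda$. -/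

import Mathlib

open scoped Matrix ComplexOrder

namespace Cloning

noncomputable section

/-- `M_n` with index type `n`; `M_d ⊗ M_d` is realised as the matrices indexed by `Fin d × Fin d`. -/
abbrev Mat (n : Type) : Type := Matrix n n ℂ

/-- The ampliation `id_k ⊗ T`, i.e. `T` applied to each block of a `k × k` block matrix. -/
def ampliation {m n : Type} (k : ℕ) (T : Mat m →ₗ[ℂ] Mat n) (M : Mat (Fin k × m)) :
    Mat (Fin k × n) :=
  Matrix.of fun x y => T (Matrix.of fun a b => M (x.1, a) (y.1, b)) x.2 y.2

/-- Complete positivity: every ampliation `id_k ⊗ T` preserves positive semidefiniteness. -/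
def IsCompletelyPositive {m n : Type} (T : Mat m →ₗ[ℂ] Mat n) : Prop :=
  ∀ (k : ℕ) (M : Mat (Fin k × m)), M.PosSemidef → (ampliation k T M).PosSemidef

/-- Quantum channels: completely positive, trace preserving linear maps. -/
def IsChannel {m n : Type} [Fintype m] [Fintype n] (T : Mat m →ₗ[ℂ] Mat n) : Prop :=
  IsCompletelyPositive T ∧ ∀ X : Mat m, (T X).trace = X.trace

/-- Density matrices: positive semidefinite of unit trace. -/
def IsState {n : Type} [Fintype n] (ρ : Mat n) : Prop :=
  ρ.PosSemidef ∧ ρ.trace = 1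

/-- The partial trace over the second tensor factor. -/
def traceSecond {d : ℕ} (X : Mat (Fin d × Fin d)) : Mat (Fin d) :=
  Matrix.of fun i j => ∑ k, X (i, k) (j, k)

/-- The partial trace over the first tensor factor. -/
def traceFirst {d : ℕ} (X : Mat (Fin d × Fin d)) : Mat (Fin d) :=
  Matrix.of fun i j => ∑ k, X (k, i) (k, j)

/-- `T` is a universal `1 → 2` cloner with singlet fractions `p = (p₁, p₂)`: it is a channel
`M_d → M_d ⊗ M_d` whose two marginals are `T_i(ρ) = p_i ρ + (1 - p_i) I / d`. -/
def IsUniversalCloner {d : ℕ} (T : Mat (Fin d) →ₗ[ℂ] Mat (Fin d × Fin d)) (p : ℝ × ℝ) : Prop :=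
  IsChannel T ∧ ∀ ρ : Mat (Fin d), IsState ρ →
    traceSecond (T ρ) = (p.1 : ℂ) • ρ + ((1 - p.1 : ℂ) / d) • (1 : Mat (Fin d)) ∧
    traceFirst (T ρ) = (p.2 : ℂ) • ρ + ((1 - p.2 : ℂ) / d) • (1 : Mat (Fin d))

/-- The achievable (admissible) pairs of singlet fractions in dimension `d`. -/
def achievableSingletFractions (d : ℕ) : Set (ℝ × ℝ) :=
  {p | ∃ T : Mat (Fin d) →ₗ[ℂ] Mat (Fin d × Fin d), IsUniversalCloner T p}

/-- Unit vectors `ψ ∈ ℂ^d`, representing the pure states `|ψ⟩⟨ψ|`. -/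
def UnitVector (d : ℕ) : Type := {ψ : Fin d → ℂ // star ψ ⬝ᵥ ψ = 1}

/-- The rank-one projection `|ψ⟩⟨ψ|`. -/
def UnitVector.proj {d : ℕ} (ψ : UnitVector d) : Mat (Fin d) :=
  Matrix.vecMulVec ψ.1 (star ψ.1)

/-- The fidelity `F(σ, |ψ⟩⟨ψ|) = ⟨ψ|σ|ψ⟩` (a real number whenever `σ` is Hermitian). -/
def fidelity {d : ℕ} (σ : Mat (Fin d)) (ψ : UnitVector d) : ℝ :=
  (star ψ.1 ⬝ᵥ (σ *ᵥ ψ.1)).re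

/-- The achievable pairs `(f₁, f₂)` of fidelities `f_i = F(ρ, T_i(ρ))`, `ρ` pure, of universal
`1 → 2` cloners. -/
def achievableFidelities (d : ℕ) : Set (ℝ × ℝ) :=
  {f | ∃ (T : Mat (Fin d) →ₗ[ℂ] Mat (Fin d × Fin d)) (p : ℝ × ℝ), IsUniversalCloner T p ∧
    ∀ ψ : UnitVector d, fidelity (traceSecond (T ψ.proj)) ψ = f.1 ∧
      fidelity (traceFirst (T ψ.proj)) ψ = f.2}

/-- The worst-case fidelity `∑ w_i inf_ψ F(|ψ⟩⟨ψ|, T_i(|ψ⟩⟨ψ|))` of `T` with weights `w`. -/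
def worstFidelity {d : ℕ} (w : ℝ × ℝ) (T : Mat (Fin d) →ₗ[ℂ] Mat (Fin d × Fin d)) : ℝ :=
  w.1 * (⨅ ψ : UnitVector d, fidelity (traceSecond (T ψ.proj)) ψ) +
  w.2 * (⨅ ψ : UnitVector d, fidelity (traceFirst (T ψ.proj)) ψ)

/-- `T` is optimal for the weights `w`: it maximises the weighted worst-case fidelity among
all channels `M_d → M_d ⊗ M_d` (whether or not these are universal). -/
def IsOptimalCloner {d : ℕ} (w : ℝ × ℝ) (T : Mat (Fin d) →ₗ[ℂ] Mat (Fin d × Fin d)) : Prop :=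
  IsChannel T ∧ ∀ S : Mat (Fin d) →ₗ[ℂ] Mat (Fin d × Fin d), IsChannel S →
    worstFidelity w S ≤ worstFidelity w T

/-- The filled ellipse of index `r` in the `(s, t)`-plane:
`t² / a² + (s - c_r)² / b² ≤ r²`, where `a = (d² - 1)^(-1/2)`, `b = (d² - 1)^(-1)`,
`c_r = (r d - 2) / (d² - 1)`. -/
def ellipse (d : ℕ) (r : ℝ) : Set (ℝ × ℝ) :=
  let a : ℝ := 1 / √((d : ℝ) ^ 2 - 1)
  let b : ℝ := 1 / ((d : ℝ) ^ 2 - 1)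
  let c : ℝ := (r * d - 2) / ((d : ℝ) ^ 2 - 1)
  {x | x.2 ^ 2 / a ^ 2 + (x.1 - c) ^ 2 / b ^ 2 ≤ r ^ 2}

/-- The pairs `(p₁, p₂)` whose coordinates `(s, t) = (p₁ + p₂, p₁ - p₂)` lie in the ellipse of
index `r`. -/
def singletEllipse (d : ℕ) (r : ℝ) : Set (ℝ × ℝ) :=
  {p | (p.1 + p.2, p.1 - p.2) ∈ ellipse d r}

/-- The pairs `(f₁, f₂)` whose coordinates `s = (d (f₁ + f₂) - 2) / (d - 1)` and
`t = d (f₁ - f₂) / (d - 1)` lie in the ellipse of index `r`. -/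
def fidelityEllipse (d : ℕ) (r : ℝ) : Set (ℝ × ℝ) :=
  {f | ((d * (f.1 + f.2) - 2) / ((d : ℝ) - 1), d * (f.1 - f.2) / ((d : ℝ) - 1)) ∈ ellipse d r}

end

end Cloning

/-! Everything is read off the Choi matrix `J` of the channel, a positive matrix of trace `d` on
reference ⊗ clone ⊗ clone. The entanglement fidelities of the two marginals are the expectations in
`J` of `W₀W₀ᴴ` and `W₁W₁ᴴ`, where `W_i` pairs the reference with clone `i`. The ranges of `W₀` and
`W₁` together span a copy of `ℂ² ⊗ ℂ^d` with projection `P`. There `pairSym` and `pairDiff / √(d² -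
1)` are Hermitian, anticommute and square to `P`, like two Pauli matrices. Their expectations
therefore lie in a disc of radius `λ = tr(JP)` (`expect_pair_bound`), with `0 ≤ λ ≤ d`. In the
coordinates `(s, t)` this disc is `E_λ`.

Conversely, every point of `E_λ` comes from `J = g (1 - P) + K`, with `K` positive on the range of
`P`. Positivity of the 2 × 2 coefficient matrix of `K` is exactly the ellipse inequality
(`exists_isUniversalCloner`).

Optimality must be tested against all channels. Instead of twirling, the worst-case fidelity is
bounded by an average over a finite set of pure states which computes the entanglement fidelity
(`entanglementFidelity_add`). Hence a channel does no better than its mean singlet fractions allow,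
and these again lie in some `E_λ`. The support function of `E_λ` in a nonzero nonnegative direction
increases strictly with `λ`, so the maximum occurs at `λ = d` and nowhere else. -/

namespace Cloning

noncomputable section

/-! ### The Pauli algebra of the pairing operators -/

/-- The map `e_m ↦ ∑ k, e_k ⊗ e_k ⊗ e_m` for `i = 0`, and `e_m ↦ ∑ k, e_k ⊗ e_m ⊗ e_k` for
`i = 1`: the input system is maximally entangled with the clone of index `i`. -/
def pairing (d : ℕ) (i : Fin 2) : Matrix (Fin d × Fin d × Fin d) (Fin d) ℂ :=
  Matrix.of fun u m =>
    if i = 0 then (if u.1 = u.2.1 then (if u.2.2 = m then 1 else 0) else 0)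
    else (if u.1 = u.2.2 then (if u.2.1 = m then 1 else 0) else 0)

/-- The operators `W_i W_jᴴ`, where `W_i` is the pairing of index `i`. -/
def pairOp (d : ℕ) (i j : Fin 2) : Mat (Fin d × Fin d × Fin d) :=
  pairing d i * (pairing d j)ᴴ

lemma pairing_conjTranspose_mul (d : ℕ) (i j : Fin 2) :
    (pairing d i)ᴴ * pairing d j = (if i = j then (d : ℂ) else 1) • (1 : Mat (Fin d)) := by
  ext m n
  by_cases hmn : m = n <;> fin_cases i <;> fin_cases j <;>
  simp [hmn, pairing, Matrix.mul_apply, Fintype.sum_prod_type, Finset.sum_ite_eq,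
    apply_ite, eq_comm]

lemma pairOp_mul (d : ℕ) (i j k l : Fin 2) :
    pairOp d i j * pairOp d k l = (if j = k then (d : ℂ) else 1) • pairOp d i l := by
  have h : pairOp d i j * pairOp d k l
      = pairing d i * ((pairing d j)ᴴ * pairing d k) * (pairing d l)ᴴ := by
    simp only [pairOp, Matrix.mul_assoc]
  rw [h, pairing_conjTranspose_mul, Matrix.mul_smul, Matrix.smul_mul, Matrix.mul_one, pairOp]

lemma pairOp_conjTranspose (d : ℕ) (i j : Fin 2) : (pairOp d i j)ᴴ = pairOp d j i := by
  simp [pairOp]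

/-- The orthogonal projection onto the sum of the ranges of the two pairings. -/
def pairProj (d : ℕ) : Mat (Fin d × Fin d × Fin d) :=
  ((d : ℂ) ^ 2 - 1)⁻¹ • ((d : ℂ) • pairOp d 0 0 + (d : ℂ) • pairOp d 1 1
    - pairOp d 0 1 - pairOp d 1 0)

/-- A symmetry of the range of `pairProj`, commuting with the exchange of the clones. -/
def pairSym (d : ℕ) : Mat (Fin d × Fin d × Fin d) :=
  pairOp d 0 0 + pairOp d 1 1 - (d : ℂ) • pairProj d

/-- The difference of the two pairing operators. -/
def pairDiff (d : ℕ) : Mat (Fin d × Fin d × Fin d) := pairOp d 0 0 - pairOp d 1 1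

lemma sq_sub_one_ne_zero {d : ℕ} (hd : 2 ≤ d) : (d : ℂ) ^ 2 - 1 ≠ 0 := by
  have h : (d ^ 2 : ℕ) ≠ 1 := by nlinarith
  rw [sub_ne_zero]
  exact_mod_cast h

/-- The coefficients of `pairProj` are the entries of the inverse of the Gram matrix `[[d, 1], [1,
d]]` of the pairings. -/
lemma pairProj_mul_self {d : ℕ} (hd : 2 ≤ d) : pairProj d * pairProj d = pairProj d := by
  have := sq_sub_one_ne_zero hd
  simp only [pairProj, mul_add, add_mul, mul_sub, sub_mul, smul_mul_assoc, mul_smul_comm,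
    pairOp_mul, Fin.isValue, one_ne_zero, zero_ne_one, if_true, if_false]
  match_scalars <;> field_simp <;> ring

lemma pairProj_mul_pairDiff {d : ℕ} (hd : 2 ≤ d) : pairProj d * pairDiff d = pairDiff d := by
  have := sq_sub_one_ne_zero hd
  simp only [pairProj, pairDiff, add_mul, mul_sub, sub_mul, smul_mul_assoc,
    pairOp_mul, Fin.isValue, one_ne_zero, zero_ne_one, if_true, if_false]
  match_scalars <;> field_simp <;> ring

lemma pairProj_mul_pairSym {d : ℕ} (hd : 2 ≤ d) : pairProj d * pairSym d = pairSym d := by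
  have := sq_sub_one_ne_zero hd
  rw [pairSym, mul_sub, mul_smul_comm, pairProj_mul_self hd]
  simp only [pairProj, mul_add, add_mul, sub_mul, smul_mul_assoc,
    pairOp_mul, Fin.isValue, one_ne_zero, zero_ne_one, if_true, if_false]
  match_scalars <;> field_simp <;> ring

lemma pairProj_isHermitian (d : ℕ) : (pairProj d).IsHermitian := by
  simp only [Matrix.IsHermitian, pairProj, Matrix.conjTranspose_smul, Matrix.conjTranspose_add,
    Matrix.conjTranspose_sub, pairOp_conjTranspose, star_inv₀, star_sub, star_pow, star_natCast,
    star_one]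
  module

lemma pairDiff_isHermitian (d : ℕ) : (pairDiff d).IsHermitian := by
  simp [Matrix.IsHermitian, pairDiff, pairOp_conjTranspose]

lemma pairSym_isHermitian (d : ℕ) : (pairSym d).IsHermitian := by
  simp [Matrix.IsHermitian, pairSym, pairOp_conjTranspose, (pairProj_isHermitian d).eq]

lemma pairDiff_mul_pairProj {d : ℕ} (hd : 2 ≤ d) : pairDiff d * pairProj d = pairDiff d := by
  have h := congrArg Matrix.conjTranspose (pairProj_mul_pairDiff hd)
  rwa [Matrix.conjTranspose_mul, (pairDiff_isHermitian d).eq, (pairProj_isHermitian d).eq] at h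

lemma pairSym_mul_pairProj {d : ℕ} (hd : 2 ≤ d) : pairSym d * pairProj d = pairSym d := by
  have h := congrArg Matrix.conjTranspose (pairProj_mul_pairSym hd)
  rwa [Matrix.conjTranspose_mul, (pairSym_isHermitian d).eq, (pairProj_isHermitian d).eq] at h

lemma pairDiff_mul_self {d : ℕ} (hd : 2 ≤ d) :
    pairDiff d * pairDiff d = ((d : ℂ) ^ 2 - 1) • pairProj d := by
  have := sq_sub_one_ne_zero hd
  simp only [pairProj, pairDiff, mul_sub, sub_mul, pairOp_mul, Fin.isValue, one_ne_zero,
    zero_ne_one, if_true, if_false]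
  match_scalars <;> field_simp

lemma pairSym_mul_self {d : ℕ} (hd : 2 ≤ d) : pairSym d * pairSym d = pairProj d := by
  have := sq_sub_one_ne_zero hd
  have h : pairSym d * pairSym d
      = (pairOp d 0 0 + pairOp d 1 1) * pairSym d - (d : ℂ) • pairSym d := by
    nth_rewrite 1 [pairSym]
    rw [sub_mul, smul_mul_assoc, pairProj_mul_pairSym hd]
  rw [h]
  simp only [pairProj, pairSym, mul_add, add_mul, mul_sub,
    mul_smul_comm, pairOp_mul, Fin.isValue, one_ne_zero, zero_ne_one, if_true, if_false]
  match_scalars <;> field_simp <;> ring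

lemma pairSym_mul_pairDiff {d : ℕ} (hd : 2 ≤ d) :
    pairSym d * pairDiff d = -(pairDiff d * pairSym d) := by
  rw [pairSym, sub_mul, mul_sub, smul_mul_assoc, mul_smul_comm, pairProj_mul_pairDiff hd,
    pairDiff_mul_pairProj hd]
  simp only [pairDiff, mul_add, add_mul, mul_sub, sub_mul, pairOp_mul, Fin.isValue, one_ne_zero,
    zero_ne_one, if_true, if_false]
  module

/-- By anticommutation `(α X + β Z)² = n² P`, so the combination is `2n` times a projection when `n
≠ 0`. Its positivity yields the disc bound. -/
lemma pair_combination_mul_self {d : ℕ} (hd : 2 ≤ d) (n α β : ℂ)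
    (h : n ^ 2 = α ^ 2 + β ^ 2 * ((d : ℂ) ^ 2 - 1)) :
    (n • pairProj d - α • pairSym d - β • pairDiff d)
        * (n • pairProj d - α • pairSym d - β • pairDiff d)
      = (2 * n) • (n • pairProj d - α • pairSym d - β • pairDiff d) := by
  simp only [mul_sub, sub_mul, smul_mul_assoc, mul_smul_comm, pairProj_mul_self hd,
    pairProj_mul_pairSym hd, pairProj_mul_pairDiff hd, pairSym_mul_pairProj hd,
    pairDiff_mul_pairProj hd, pairSym_mul_self hd, pairDiff_mul_self hd, pairSym_mul_pairDiff hd]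
  match_scalars
  · linear_combination -h
  all_goals ring

/-! ### Expectations in a positive matrix -/

/-- The real part of `tr (J M)`. -/
def expect {n : Type} [Fintype n] (J M : Mat n) : ℝ := (J * M).trace.re

section
variable {n : Type} [Fintype n] (J M N : Mat n)

lemma expect_add : expect J (M + N) = expect J M + expect J N := by
  simp [expect, mul_add]

lemma expect_sub : expect J (M - N) = expect J M - expect J N := by
  simp [expect, mul_sub]

lemma expect_smul (c : ℝ) : expect J ((c : ℂ) • M) = c * expect J M := by
  simp [expect]

variable {J M} in
lemma expect_mul_self_nonneg (hJ : J.PosSemidef) (hM : M.IsHermitian) :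
    0 ≤ expect J (M * M) := by
  have h := (hJ.mul_mul_conjTranspose_same M).trace_nonneg
  rw [hM.eq, Matrix.mul_assoc, Matrix.trace_mul_comm, Matrix.mul_assoc] at h
  exact (Complex.le_def.1 h).1

end

/-- The joint numerical range of the two pairing operators. -/
lemma expect_pair_bound {d : ℕ} (hd : 2 ≤ d) {J : Mat (Fin d × Fin d × Fin d)}
    (hJ : J.PosSemidef) :
    expect J (pairDiff d) ^ 2 / ((d : ℝ) ^ 2 - 1) + expect J (pairSym d) ^ 2
      ≤ expect J (pairProj d) ^ 2 := by
  have hD : (0 : ℝ) < (d : ℝ) ^ 2 - 1 := by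
    have : (2 : ℝ) ≤ d := by exact_mod_cast hd
    nlinarith
  set u := expect J (pairSym d)
  set v := expect J (pairDiff d)
  set q := expect J (pairProj d)
  have hq : 0 ≤ q := by
    have := expect_mul_self_nonneg hJ (pairProj_isHermitian d)
    rwa [pairProj_mul_self hd] at this
  set n := √(v ^ 2 / ((d : ℝ) ^ 2 - 1) + u ^ 2) with hn
  have hn2 : n ^ 2 = v ^ 2 / ((d : ℝ) ^ 2 - 1) + u ^ 2 := Real.sq_sqrt (by positivity)
  rw [← hn2]
  have hn0 : 0 ≤ n := Real.sqrt_nonneg _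
  refine pow_le_pow_left₀ hn0 ?_ 2
  rcases hn0.eq_or_lt with h0 | hpos
  · rwa [← h0]
  -- With `α = u` and this `β`, the tested operator points along the vector of expectations itself,
  -- and its positivity reads `n² ≤ n q`.
  set β := v / ((d : ℝ) ^ 2 - 1) with hβ
  have hnβ : n ^ 2 = u ^ 2 + β ^ 2 * ((d : ℝ) ^ 2 - 1) := by
    rw [hn2, hβ]; field_simp; ring
  have hc := pair_combination_mul_self hd (n : ℂ) u β (by exact_mod_cast hnβ)
  have hH : ((n : ℂ) • pairProj d - (u : ℂ) • pairSym d - (β : ℂ) • pairDiff d).IsHermitian := by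
    simp [Matrix.IsHermitian, (pairProj_isHermitian d).eq, (pairSym_isHermitian d).eq,
      (pairDiff_isHermitian d).eq]
  have h := expect_mul_self_nonneg hJ hH
  rw [hc, show (2 * (n : ℂ)) = ((2 * n : ℝ) : ℂ) by push_cast; rfl, expect_smul, expect_sub,
    expect_sub, expect_smul, expect_smul, expect_smul] at h
  have h1 : 0 ≤ n * q - u * u - β * v := by
    have : 0 < 2 * n := by positivity
    exact nonneg_of_mul_nonneg_right h this
  have h2 : u * u + β * v = n ^ 2 := by rw [hn2, hβ]; field_simp; ring
  have h3 : n * n ≤ n * q := by nlinarith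
  exact le_of_mul_le_mul_left h3 hpos

lemma one_sub_pairProj_posSemidef {d : ℕ} (hd : 2 ≤ d) : (1 - pairProj d).PosSemidef := by
  have h1 : (1 - pairProj d)ᴴ = 1 - pairProj d := by
    simp [(pairProj_isHermitian d).eq]
  have h2 : (1 - pairProj d) * (1 - pairProj d) = 1 - pairProj d := by
    simp [mul_sub, sub_mul, pairProj_mul_self hd]
  have h := Matrix.posSemidef_self_mul_conjTranspose (1 - pairProj d)
  rwa [h1, h2] at h

lemma expect_pairProj_le {d : ℕ} (hd : 2 ≤ d) {J : Mat (Fin d × Fin d × Fin d)}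
    (hJ : J.PosSemidef) : expect J (pairProj d) ≤ J.trace.re := by
  have h1 : (1 - pairProj d).IsHermitian := (one_sub_pairProj_posSemidef hd).isHermitian
  have h2 : (1 - pairProj d) * (1 - pairProj d) = 1 - pairProj d := by
    simp [mul_sub, sub_mul, pairProj_mul_self hd]
  have h := expect_mul_self_nonneg hJ h1
  rw [h2, expect_sub] at h
  simpa [expect] using h

lemma expect_pairProj_nonneg {d : ℕ} (hd : 2 ≤ d) {J : Mat (Fin d × Fin d × Fin d)}
    (hJ : J.PosSemidef) : 0 ≤ expect J (pairProj d) := by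
  have := expect_mul_self_nonneg hJ (pairProj_isHermitian d)
  rwa [pairProj_mul_self hd] at this

/-! ### Choi matrices and entanglement fidelity -/

/-- The Choi matrix of `T`. -/
def choi {d : ℕ} {n : Type} (T : Mat (Fin d) →ₗ[ℂ] Mat n) : Mat (Fin d × n) :=
  Matrix.of fun u v => T (Matrix.single u.1 v.1 1) u.2 v.2

lemma choi_posSemidef {d : ℕ} {n : Type} {T : Mat (Fin d) →ₗ[ℂ] Mat n}
    (hT : IsCompletelyPositive T) : (choi T).PosSemidef := by
  -- The unnormalised maximally entangled vector: the Choi matrix is the ampliation of its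
  -- projector, with `k = d`.
  let φ : Fin d × Fin d → ℂ := fun x => if x.1 = x.2 then 1 else 0
  have h := hT d _ (Matrix.posSemidef_vecMulVec_self_star φ)
  convert h using 1
  ext u v
  have hs : Matrix.single u.1 v.1 (1 : ℂ) = Matrix.of fun a b =>
      Matrix.vecMulVec φ (star φ) (u.1, a) (v.1, b) := by
    ext a b
    by_cases h1 : u.1 = a <;> by_cases h2 : v.1 = b <;>
      simp [φ, Matrix.vecMulVec_apply, h1, h2]
  simp only [choi, ampliation, Matrix.of_apply, hs]

/-- The (unnormalised) entanglement fidelity `∑ k l, ⟨k| L(|k⟩⟨l|) |l⟩` of a map `L`. -/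
def entanglementFidelity {d : ℕ} (L : Mat (Fin d) →ₗ[ℂ] Mat (Fin d)) : ℝ :=
  (∑ k, ∑ l, L (Matrix.single k l 1) k l).re

/-- `traceSecond` as a linear map. -/
def traceSecondL (d : ℕ) : Mat (Fin d × Fin d) →ₗ[ℂ] Mat (Fin d) where
  toFun := traceSecond
  map_add' X Y := by ext; simp [traceSecond, Finset.sum_add_distrib]
  map_smul' c X := by ext; simp [traceSecond, Finset.mul_sum]

/-- `traceFirst` as a linear map. -/
def traceFirstL (d : ℕ) : Mat (Fin d × Fin d) →ₗ[ℂ] Mat (Fin d) where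
  toFun := traceFirst
  map_add' X Y := by ext; simp [traceFirst, Finset.sum_add_distrib]
  map_smul' c X := by ext; simp [traceFirst, Finset.mul_sum]

lemma traceSecond_trace {d : ℕ} (X : Mat (Fin d × Fin d)) : (traceSecond X).trace = X.trace := by
  simp [traceSecond, Matrix.trace, Fintype.sum_prod_type]

lemma traceFirst_trace {d : ℕ} (X : Mat (Fin d × Fin d)) : (traceFirst X).trace = X.trace := by
  simp only [traceFirst, Matrix.trace, Fintype.sum_prod_type, Matrix.diag_apply, Matrix.of_apply]
  exact Finset.sum_comm

section
variable {d : ℕ} (T : Mat (Fin d) →ₗ[ℂ] Mat (Fin d × Fin d))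

lemma pairOp_zero_zero_apply (u v : Fin d × Fin d × Fin d) : pairOp d 0 0 u v =
    if u.1 = u.2.1 then (if v.1 = v.2.1 then (if u.2.2 = v.2.2 then 1 else 0) else 0) else 0 := by
  simp only [pairOp, pairing, Matrix.mul_apply, Matrix.conjTranspose_apply, Matrix.of_apply]
  split_ifs <;> simp_all [eq_comm]

lemma pairOp_one_one_apply (u v : Fin d × Fin d × Fin d) : pairOp d 1 1 u v =
    if u.1 = u.2.2 then (if v.1 = v.2.2 then (if u.2.1 = v.2.1 then 1 else 0) else 0) else 0 := by
  simp only [pairOp, pairing, Matrix.mul_apply, Matrix.conjTranspose_apply, Matrix.of_apply]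
  split_ifs <;> simp_all [eq_comm]

lemma pairOp_zero_one_apply (u v : Fin d × Fin d × Fin d) : pairOp d 0 1 u v =
    if u.1 = u.2.1 then (if v.1 = v.2.2 then (if u.2.2 = v.2.1 then 1 else 0) else 0) else 0 := by
  simp only [pairOp, pairing, Matrix.mul_apply, Matrix.conjTranspose_apply, Matrix.of_apply]
  split_ifs <;> simp_all [eq_comm]

lemma pairOp_one_zero_apply (u v : Fin d × Fin d × Fin d) : pairOp d 1 0 u v =
    if u.1 = u.2.2 then (if v.1 = v.2.1 then (if u.2.1 = v.2.2 then 1 else 0) else 0) else 0 := by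
  simp only [pairOp, pairing, Matrix.mul_apply, Matrix.conjTranspose_apply, Matrix.of_apply]
  split_ifs <;> simp_all [eq_comm]

lemma expect_choi_zero :
    expect (choi T) (pairOp d 0 0) = entanglementFidelity (traceSecondL d ∘ₗ T) := by
  simp [expect, entanglementFidelity, Matrix.trace, Matrix.mul_apply, choi,
    pairOp_zero_zero_apply, Fintype.sum_prod_type, traceSecondL, traceSecond]
  exact Finset.sum_congr rfl fun _ _ => Finset.sum_comm

lemma expect_choi_one :
    expect (choi T) (pairOp d 1 1) = entanglementFidelity (traceFirstL d ∘ₗ T) := by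
  simp [expect, entanglementFidelity, Matrix.trace, Matrix.mul_apply, choi,
    pairOp_one_one_apply, Fintype.sum_prod_type, traceFirstL, traceFirst]
  exact Finset.sum_congr rfl fun _ _ => Finset.sum_comm

lemma choi_trace (hT : ∀ X, (T X).trace = X.trace) : (choi T).trace = d := by
  have h : (choi T).trace = ∑ k, (T (Matrix.single k k 1)).trace := by
    simp [Matrix.trace, Fintype.sum_prod_type, choi]
  simp [h, hT]

end

variable {d : ℕ}

/-! ### Averaging fidelities over finitely many pure states -/

/-- The standard basis vectors of `ℂ^d`. -/
def basisVector (m : Fin d) : UnitVector d := ⟨Pi.single m 1, by simp⟩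

/-- The vectors of `ℂ^d` whose coordinates are cube roots of unity divided by `√d`. -/
def phaseVector [NeZero d] (f : Fin d → ZMod 3) : UnitVector d :=
  ⟨fun k => ((√d)⁻¹ : ℝ) * ZMod.stdAddChar (f k), by
    have hd : (d : ℝ) ≠ 0 := by exact_mod_cast NeZero.ne d
    have h : ∀ k, star (((√d)⁻¹ : ℝ) * ZMod.stdAddChar (f k) : ℂ)
        * (((√d)⁻¹ : ℝ) * ZMod.stdAddChar (f k)) = ((d : ℝ)⁻¹ : ℝ) := by
      intro k
      rw [Complex.star_def, Complex.conj_mul', norm_mul, AddChar.norm_apply, mul_one,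
        Complex.norm_real, ← Complex.ofReal_pow, Real.norm_eq_abs, sq_abs, inv_pow,
        Real.sq_sqrt (Nat.cast_nonneg d)]
    simp only [dotProduct, Pi.star_apply, h]
    simp [NeZero.ne d]⟩

lemma fidelity_proj_eq_sum (L : Mat (Fin d) →ₗ[ℂ] Mat (Fin d)) (ψ : UnitVector d) :
    fidelity (L ψ.proj) ψ = (∑ i, ∑ j, ∑ k, ∑ l,
      (star (ψ.1 i) * ψ.1 j * ψ.1 k * star (ψ.1 l)) * L (Matrix.single k l 1) i j).re := by
  have h : ∀ i j, L ψ.proj i j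
      = ∑ k, ∑ l, ψ.1 k * star (ψ.1 l) * L (Matrix.single k l 1) i j := by
    intro i j
    conv_lhs => rw [Matrix.matrix_eq_sum_single ψ.proj]
    have hs : ∀ k l, Matrix.single k l (ψ.proj k l)
        = (ψ.1 k * star (ψ.1 l)) • Matrix.single k l (1 : ℂ) := by
      intro k l
      simp [UnitVector.proj, Matrix.vecMulVec_apply]
    simp only [hs, map_sum, map_smul, Matrix.sum_apply, Matrix.smul_apply, smul_eq_mul]
  simp only [fidelity, dotProduct, Matrix.mulVec, h, Finset.mul_sum, Finset.sum_mul, Pi.star_apply]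
  congr 1
  refine Finset.sum_congr rfl fun i _ => Finset.sum_congr rfl fun j _ =>
    Finset.sum_congr rfl fun k _ => Finset.sum_congr rfl fun l _ => ?_
  ring

lemma fidelity_basisVector (L : Mat (Fin d) →ₗ[ℂ] Mat (Fin d)) (m : Fin d) :
    fidelity (L (basisVector m).proj) (basisVector m) = (L (Matrix.single m m 1) m m).re := by
  have h : (basisVector m).proj = Matrix.single m m 1 := by
    simp [basisVector, UnitVector.proj, Matrix.single_eq_single_vecMulVec_single]
  simp [fidelity, h]
  simp [basisVector]

/-- Orthogonality of characters: the sum vanishes unless `j, k` and `i, l` agree as multisets. -/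
lemma sum_stdAddChar (i j k l : Fin d) :
    ∑ f : Fin d → ZMod 3, ZMod.stdAddChar (f j + f k - f i - f l)
      = if (i = j ∧ k = l) ∨ (i = k ∧ j = l) then (3 : ℂ) ^ d else 0 := by
  split_ifs with h
  · have : ∀ f : Fin d → ZMod 3, f j + f k - f i - f l = 0 := by
      rintro f
      rcases h with ⟨rfl, rfl⟩ | ⟨rfl, rfl⟩ <;> ring
    simp [this, ZMod.card]
  · let φ : (Fin d → ZMod 3) →+ ZMod 3 :=
      Pi.evalAddMonoidHom (fun _ : Fin d => ZMod 3) j + Pi.evalAddMonoidHom (fun _ : Fin d => ZMod 3) k - Pi.evalAddMonoidHom (fun _ : Fin d => ZMod 3) i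
        - Pi.evalAddMonoidHom (fun _ : Fin d => ZMod 3) l
    have hφ : ∀ f, φ f = f j + f k - f i - f l := fun f => rfl
    have hne : ∃ f, φ f ≠ 0 := by
      -- This is why cube roots of unity are used: with signs, the terms `j = k`, `i = l` would
      -- survive as well.
      have h2 : (1 + 1 : ZMod 3) ≠ 0 := by decide
      by_cases hij : i = j
      · refine ⟨Pi.single k 1, ?_⟩
        have hkl : l ≠ k := fun e => h (Or.inl ⟨hij, e.symm⟩)
        simp [hφ, hij, Pi.single_apply, hkl]
      · by_cases hjl : j = l
        · refine ⟨Pi.single i 1, ?_⟩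
          have hik : k ≠ i := fun e => h (Or.inr ⟨e.symm, hjl⟩)
          simp [hφ, ← hjl, hik, Ne.symm hij]
        · refine ⟨Pi.single j 1, ?_⟩
          by_cases hkj : k = j <;> simp [hφ, hij, Ne.symm hjl, hkj, h2]
    obtain ⟨f, hf⟩ := hne
    refine AddChar.sum_eq_zero_of_ne_one (ψ := ZMod.stdAddChar.compAddMonoidHom φ) fun e => hf ?_
    apply ZMod.injective_stdAddChar
    simpa using DFunLike.congr_fun e f

/-- The pattern `i = j, k = l` gives the trace term `d`, and `i = k, j = l` gives the entanglement
fidelity. The all-equal terms, counted twice, are subtracted once; the basis vectors will restore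
them. -/
lemma sum_fidelity_phaseVector [NeZero d] (L : Mat (Fin d) →ₗ[ℂ] Mat (Fin d))
    (hL : ∀ X, (L X).trace = X.trace) :
    (d : ℝ) ^ 2 / 3 ^ d * ∑ f, fidelity (L (phaseVector f).proj) (phaseVector f)
      = entanglementFidelity L + d - ∑ m, (L (Matrix.single m m 1) m m).re := by
  have hd : (d : ℂ) ≠ 0 := by exact_mod_cast NeZero.ne d
  have hterm : ∀ (f : Fin d → ZMod 3) (i j k l : Fin d),
      star ((phaseVector f).1 i) * (phaseVector f).1 j * (phaseVector f).1 k
        * star ((phaseVector f).1 l)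
      = ((d : ℂ) ^ 2)⁻¹ * ZMod.stdAddChar (f j + f k - f i - f l) := by
    intro f i j k l
    have hs : (((√d)⁻¹ : ℝ) : ℂ) ^ 4 = ((d : ℂ) ^ 2)⁻¹ := by
      rw [← Complex.ofReal_pow, inv_pow, show √(d : ℝ) ^ 4 = (√d ^ 2) ^ 2 by ring,
        Real.sq_sqrt (Nat.cast_nonneg d)]
      push_cast; rfl
    simp only [phaseVector, sub_eq_add_neg, AddChar.map_add_eq_mul, AddChar.map_neg_eq_conj,
      star_mul', Complex.star_def, Complex.conj_ofReal, ← hs]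
    ring
  have hval : ∀ i j k l : Fin d,
      (if (i = j ∧ k = l) ∨ (i = k ∧ j = l) then (3 : ℂ) ^ d else 0)
      = 3 ^ d * ((if i = j then if k = l then 1 else 0 else 0)
        + (if i = k then if j = l then 1 else 0 else 0)
        - (if i = j then if i = k then if i = l then 1 else 0 else 0 else 0)) := by
    intro i j k l
    by_cases h1 : i = j <;> by_cases h2 : k = l <;> by_cases h3 : i = k <;> by_cases h4 : j = l <;>
      simp_all
  have htr : ∑ i, ∑ k, L (Matrix.single k k 1) i i = d := by
    rw [Finset.sum_comm]
    have : ∀ k, ∑ i, L (Matrix.single k k 1) i i = 1 := by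
      intro k
      have := hL (Matrix.single k k 1)
      simpa [Matrix.trace] using this
    simp [this]
  have hc : (d : ℂ) ^ 2 / 3 ^ d * ∑ f : Fin d → ZMod 3, ∑ i, ∑ j, ∑ k, ∑ l,
      (star ((phaseVector f).1 i) * (phaseVector f).1 j * (phaseVector f).1 k
        * star ((phaseVector f).1 l)) * L (Matrix.single k l 1) i j
      = ∑ k, ∑ l, L (Matrix.single k l 1) k l + d - ∑ m, L (Matrix.single m m 1) m m := by
    simp only [hterm]
    rw [Finset.sum_comm]
    have : ∀ i, ∑ f : Fin d → ZMod 3, ∑ j, ∑ k, ∑ l,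
        ((d : ℂ) ^ 2)⁻¹ * ZMod.stdAddChar (f j + f k - f i - f l) * L (Matrix.single k l 1) i j
        = ∑ j, ∑ k, ∑ l, ((d : ℂ) ^ 2)⁻¹ * (∑ f : Fin d → ZMod 3,
          ZMod.stdAddChar (f j + f k - f i - f l)) * L (Matrix.single k l 1) i j := by
      intro i
      rw [Finset.sum_comm]
      refine Finset.sum_congr rfl fun j _ => ?_
      rw [Finset.sum_comm]
      refine Finset.sum_congr rfl fun k _ => ?_
      rw [Finset.sum_comm]
      refine Finset.sum_congr rfl fun l _ => ?_
      rw [Finset.mul_sum, Finset.sum_mul]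
    simp only [this, sum_stdAddChar, hval]
    have hsum : ∑ i, ∑ j, ∑ k, ∑ l, ((if i = j then if k = l then 1 else 0 else 0)
        + (if i = k then if j = l then 1 else 0 else 0)
        - (if i = j then if i = k then if i = l then 1 else 0 else 0 else 0))
          * L (Matrix.single k l 1) i j
        = (d : ℂ) + ∑ k, ∑ l, L (Matrix.single k l 1) k l - ∑ m, L (Matrix.single m m 1) m m := by
      simp [add_mul, sub_mul, Finset.sum_add_distrib, Finset.sum_sub_distrib, ite_mul, htr]
    rw [add_comm _ (d : ℂ), ← hsum]
    simp only [Finset.mul_sum]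
    refine Finset.sum_congr rfl fun i _ => Finset.sum_congr rfl fun j _ =>
      Finset.sum_congr rfl fun k _ => Finset.sum_congr rfl fun l _ => ?_
    field_simp
  have hre := congrArg Complex.re hc
  rw [show ((d : ℂ) ^ 2 / 3 ^ d) = ((d ^ 2 / 3 ^ d : ℝ) : ℂ) by push_cast; rfl,
    Complex.re_ofReal_mul, Complex.re_sum] at hre
  simp only [← fidelity_proj_eq_sum] at hre
  rw [hre, entanglementFidelity]
  simp

/-- The entanglement fidelity of a trace preserving map as an average of fidelities over pure
states. -/
lemma entanglementFidelity_add [NeZero d] (L : Mat (Fin d) →ₗ[ℂ] Mat (Fin d))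
    (hL : ∀ X, (L X).trace = X.trace) :
    entanglementFidelity L + d
      = (d : ℝ) ^ 2 / 3 ^ d * ∑ f, fidelity (L (phaseVector f).proj) (phaseVector f)
        + ∑ m, fidelity (L (basisVector m).proj) (basisVector m) := by
  rw [sum_fidelity_phaseVector L hL]
  simp only [fidelity_basisVector]
  ring

/-- The averaging weights are positive with total `d²` on the phase vectors and `d` on the basis
vectors. -/
lemma le_entanglementFidelity [NeZero d] (L : Mat (Fin d) →ₗ[ℂ] Mat (Fin d))
    (hL : ∀ X, (L X).trace = X.trace) {c : ℝ} (hc : ∀ ψ, c ≤ fidelity (L ψ.proj) ψ) :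
    ((d : ℝ) ^ 2 + d) * c ≤ entanglementFidelity L + d := by
  rw [entanglementFidelity_add L hL]
  have h1 : ∑ _f : Fin d → ZMod 3, c
      ≤ ∑ f, fidelity (L (phaseVector f).proj) (phaseVector f) :=
    Finset.sum_le_sum fun f _ => hc _
  have h2 : ∑ _m : Fin d, c ≤ ∑ m, fidelity (L (basisVector m).proj) (basisVector m) :=
    Finset.sum_le_sum fun f _ => hc _
  have h3 := mul_le_mul_of_nonneg_left h1 (show (0 : ℝ) ≤ (d : ℝ) ^ 2 / 3 ^ d by positivity)
  have h4 : (d : ℝ) ^ 2 / 3 ^ d * ∑ _f : Fin d → ZMod 3, c = (d : ℝ) ^ 2 * c := by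
    simp [ZMod.card]
    field_simp
  simp only [Finset.sum_const, Finset.card_univ, Fintype.card_fin, nsmul_eq_mul] at h2
  linarith

lemma entanglementFidelity_of_fidelity_eq [NeZero d] (L : Mat (Fin d) →ₗ[ℂ] Mat (Fin d))
    (hL : ∀ X, (L X).trace = X.trace) {c : ℝ} (hc : ∀ ψ, fidelity (L ψ.proj) ψ = c) :
    entanglementFidelity L = ((d : ℝ) ^ 2 + d) * c - d := by
  have h := entanglementFidelity_add L hL
  simp only [hc] at h
  simp [ZMod.card] at h
  field_simp at h
  linarith

/-! ### Constructing cloners from Choi matrices -/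

/-- The linear map with Choi matrix `J`. -/
def ofChoi {n : Type} (J : Mat (Fin d × n)) : Mat (Fin d) →ₗ[ℂ] Mat n where
  toFun X := Matrix.of fun x y => ∑ k, ∑ l, X k l * J (k, x) (l, y)
  map_add' X Y := by ext; simp [add_mul, Finset.sum_add_distrib]
  map_smul' c X := by ext; simp [Finset.mul_sum, mul_assoc]

lemma ofChoi_apply {n : Type} (J : Mat (Fin d × n)) (X : Mat (Fin d)) (x y : n) :
    ofChoi J X x y = ∑ k, ∑ l, X k l * J (k, x) (l, y) := rfl

lemma ofChoi_add {n : Type} (J K : Mat (Fin d × n)) : ofChoi (J + K) = ofChoi J + ofChoi K := by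
  ext; simp [ofChoi_apply, mul_add, Finset.sum_add_distrib]

lemma ofChoi_smul {n : Type} (c : ℂ) (J : Mat (Fin d × n)) : ofChoi (c • J) = c • ofChoi J := by
  ext; simp [ofChoi_apply, Finset.mul_sum, mul_left_comm]

lemma ofChoi_isCompletelyPositive {n : Type} [Fintype n] [DecidableEq n] {J : Mat (Fin d × n)}
    (hJ : J.PosSemidef) : IsCompletelyPositive (ofChoi J) := by
  intro p M hM
  -- `C` contracts the input index of `M` with the reference index of `J`, so the ampliation is a
  -- compression of `M ⊗ J`.
  let C : Matrix ((Fin p × Fin d) × Fin d × n) (Fin p × n) ℂ := Matrix.of fun u v =>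
    if u.1.1 = v.1 then (if u.1.2 = u.2.1 then (if u.2.2 = v.2 then 1 else 0) else 0) else 0
  have h := (hM.kronecker hJ).conjTranspose_mul_mul_same C
  have e : ampliation p (ofChoi J) M = Cᴴ * Matrix.kroneckerMap (· * ·) M J * C := ?_
  · rwa [e]
  ext u v
  simp only [ampliation, Matrix.of_apply, ofChoi_apply, Matrix.mul_apply, C,
    Matrix.conjTranspose_apply, Matrix.kroneckerMap_apply, Fintype.sum_prod_type]
  simp [apply_ite, ite_mul]
  exact Finset.sum_comm

lemma ofChoi_one (X : Mat (Fin d)) :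
    traceSecond (ofChoi (1 : Mat (Fin d × Fin d × Fin d)) X) = ((d : ℂ) * X.trace) • 1 ∧
    traceFirst (ofChoi (1 : Mat (Fin d × Fin d × Fin d)) X) = ((d : ℂ) * X.trace) • 1 := by
  constructor <;> ext i j <;> by_cases h : i = j <;>
    simp [traceSecond, traceFirst, ofChoi_apply, Matrix.one_apply, Matrix.trace, h, ite_and]

lemma ofChoi_pairOp_zero_zero (X : Mat (Fin d)) :
    traceSecond (ofChoi (pairOp d 0 0) X) = (d : ℂ) • X ∧
    traceFirst (ofChoi (pairOp d 0 0) X) = X.trace • 1 := by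
  constructor <;> ext i j <;>
    simp [traceSecond, traceFirst, ofChoi_apply, pairOp_zero_zero_apply, Matrix.one_apply,
      Matrix.trace]

lemma ofChoi_pairOp_one_one (X : Mat (Fin d)) :
    traceSecond (ofChoi (pairOp d 1 1) X) = X.trace • 1 ∧
    traceFirst (ofChoi (pairOp d 1 1) X) = (d : ℂ) • X := by
  constructor <;> ext i j <;>
    simp [traceSecond, traceFirst, ofChoi_apply, pairOp_one_one_apply, Matrix.one_apply,
      Matrix.trace]

lemma ofChoi_pairOp_zero_one (X : Mat (Fin d)) :
    traceSecond (ofChoi (pairOp d 0 1) X) = X ∧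
    traceFirst (ofChoi (pairOp d 0 1) X) = X := by
  constructor <;> ext i j <;>
    simp [traceSecond, traceFirst, ofChoi_apply, pairOp_zero_one_apply]

lemma ofChoi_pairOp_one_zero (X : Mat (Fin d)) :
    traceSecond (ofChoi (pairOp d 1 0) X) = X ∧
    traceFirst (ofChoi (pairOp d 1 0) X) = X := by
  constructor <;> ext i j <;>
    simp [traceSecond, traceFirst, ofChoi_apply, pairOp_one_zero_apply]

lemma traceSecond_add (X Y : Mat (Fin d × Fin d)) :
    traceSecond (X + Y) = traceSecond X + traceSecond Y := (traceSecondL d).map_add X Y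

lemma traceSecond_smul (c : ℂ) (X : Mat (Fin d × Fin d)) :
    traceSecond (c • X) = c • traceSecond X := (traceSecondL d).map_smul c X

lemma traceFirst_add (X Y : Mat (Fin d × Fin d)) :
    traceFirst (X + Y) = traceFirst X + traceFirst Y := (traceFirstL d).map_add X Y

lemma traceFirst_smul (c : ℂ) (X : Mat (Fin d × Fin d)) :
    traceFirst (c • X) = c • traceFirst X := (traceFirstL d).map_smul c X

/-- The positive operators supported on the range of the two pairings. -/
lemma pair_combination_posSemidef {A B C : ℝ} (hA : 0 ≤ A) (hB : 0 ≤ B) (hC : C ^ 2 ≤ A * B) :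
    ((A : ℂ) • pairOp d 0 0 + (B : ℂ) • pairOp d 1 1 + (C : ℂ) • pairOp d 0 1
      + (C : ℂ) • pairOp d 1 0).PosSemidef := by
  have hpsd : ∀ i, (pairOp d i i).PosSemidef := fun i =>
    Matrix.posSemidef_self_mul_conjTranspose _
  rcases hA.eq_or_lt with rfl | hA'
  · have : C = 0 := by nlinarith
    subst this
    simpa using (hpsd 1).smul (a := (B : ℂ)) (by exact_mod_cast hB)
  -- Completing the square: `A⁻¹ (A W₀ + C W₁)(A W₀ + C W₁)ᴴ + (B - C²/A) W₁W₁ᴴ`.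
  · have h1 := (Matrix.posSemidef_self_mul_conjTranspose
      ((A : ℂ) • pairing d 0 + (C : ℂ) • pairing d 1)).smul (a := ((A⁻¹ : ℝ) : ℂ))
      (by exact_mod_cast (inv_pos.2 hA').le)
    have h2 := (hpsd 1).smul (a := ((B - C ^ 2 / A : ℝ) : ℂ)) (by
      have : C ^ 2 / A ≤ B := by rw [div_le_iff₀ hA']; linarith
      exact_mod_cast sub_nonneg.2 this)
    convert h1.add h2 using 1
    have hA0 : (A : ℂ) ≠ 0 := by exact_mod_cast hA'.ne'
    simp only [pairOp, Matrix.conjTranspose_add, Matrix.conjTranspose_smul, Matrix.mul_add,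
      Matrix.add_mul, Matrix.smul_mul, Matrix.mul_smul, Complex.star_def, Complex.conj_ofReal]
    push_cast
    match_scalars <;> field_simp
    ring

/-- The cloner with Choi matrix `g + A W₀W₀ᴴ + B W₁W₁ᴴ + C (W₀W₁ᴴ + W₁W₀ᴴ)`. -/
lemma isUniversalCloner_ofChoi (hd : d ≠ 0) {g A B C : ℝ}
    (hJ : ((g : ℂ) • 1 + (A : ℂ) • pairOp d 0 0 + (B : ℂ) • pairOp d 1 1
      + (C : ℂ) • pairOp d 0 1 + (C : ℂ) • pairOp d 1 0).PosSemidef)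
    (htr : g * d ^ 2 + d * A + d * B + 2 * C = 1) :
    IsUniversalCloner (ofChoi ((g : ℂ) • 1 + (A : ℂ) • pairOp d 0 0 + (B : ℂ) • pairOp d 1 1
      + (C : ℂ) • pairOp d 0 1 + (C : ℂ) • pairOp d 1 0)) (d * A + 2 * C, d * B + 2 * C) := by
  have hd' : (d : ℂ) ≠ 0 := by exact_mod_cast hd
  have htr' : (g : ℂ) * d ^ 2 + d * A + d * B + 2 * C = 1 := by exact_mod_cast htr
  have h2 : ∀ X, traceSecond (ofChoi ((g : ℂ) • 1 + (A : ℂ) • pairOp d 0 0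
      + (B : ℂ) • pairOp d 1 1 + (C : ℂ) • pairOp d 0 1 + (C : ℂ) • pairOp d 1 0) X)
      = ((d : ℂ) * A + 2 * C) • X + ((g * d + B) * X.trace) • 1 := by
    intro X
    simp only [ofChoi_add, ofChoi_smul, LinearMap.add_apply, LinearMap.smul_apply,
      traceSecond_add, traceSecond_smul, (ofChoi_one X).1, (ofChoi_pairOp_zero_zero X).1,
      (ofChoi_pairOp_one_one X).1, (ofChoi_pairOp_zero_one X).1, (ofChoi_pairOp_one_zero X).1]
    module
  have h1 : ∀ X, traceFirst (ofChoi ((g : ℂ) • 1 + (A : ℂ) • pairOp d 0 0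
      + (B : ℂ) • pairOp d 1 1 + (C : ℂ) • pairOp d 0 1 + (C : ℂ) • pairOp d 1 0) X)
      = ((d : ℂ) * B + 2 * C) • X + ((g * d + A) * X.trace) • 1 := by
    intro X
    simp only [ofChoi_add, ofChoi_smul, LinearMap.add_apply, LinearMap.smul_apply,
      traceFirst_add, traceFirst_smul, (ofChoi_one X).2, (ofChoi_pairOp_zero_zero X).2,
      (ofChoi_pairOp_one_one X).2, (ofChoi_pairOp_zero_one X).2, (ofChoi_pairOp_one_zero X).2]
    module
  refine ⟨⟨ofChoi_isCompletelyPositive hJ, fun X => ?_⟩, fun ρ hρ => ⟨?_, ?_⟩⟩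
  · rw [← traceSecond_trace, h2]
    simp only [Matrix.trace_add, Matrix.trace_smul, Matrix.trace_one, Fintype.card_fin,
      smul_eq_mul]
    linear_combination X.trace * htr'
  · rw [h2, hρ.2]
    congr 2
    · push_cast; ring
    · push_cast
      field_simp
      linear_combination htr'
  · rw [h1, hρ.2]
    congr 2
    · push_cast; ring
    · push_cast
      field_simp
      linear_combination htr'

lemma mem_singletEllipse (hd : 2 ≤ d) {r : ℝ} {p : ℝ × ℝ} :
    p ∈ singletEllipse d r ↔ ((d : ℝ) ^ 2 - 1) * (p.1 - p.2) ^ 2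
      + (((d : ℝ) ^ 2 - 1) * (p.1 + p.2) - (r * d - 2)) ^ 2 ≤ r ^ 2 := by
  have hD : (0 : ℝ) < (d : ℝ) ^ 2 - 1 := by
    have : (2 : ℝ) ≤ d := by exact_mod_cast hd
    nlinarith
  have h : (p.1 - p.2) ^ 2 / (1 / √((d : ℝ) ^ 2 - 1)) ^ 2
      + (p.1 + p.2 - (r * d - 2) / ((d : ℝ) ^ 2 - 1)) ^ 2 / (1 / ((d : ℝ) ^ 2 - 1)) ^ 2
      = ((d : ℝ) ^ 2 - 1) * (p.1 - p.2) ^ 2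
      + (((d : ℝ) ^ 2 - 1) * (p.1 + p.2) - (r * d - 2)) ^ 2 := by
    rw [div_pow, Real.sq_sqrt hD.le]
    field_simp
  simp only [singletEllipse, ellipse, Set.mem_ofPred_eq]
  rw [h]

lemma exists_isUniversalCloner (hd : 2 ≤ d) {r : ℝ} (hr : r ∈ Set.Icc (0 : ℝ) d) {p : ℝ × ℝ}
    (hp : p ∈ singletEllipse d r) :
    ∃ T : Mat (Fin d) →ₗ[ℂ] Mat (Fin d × Fin d), IsUniversalCloner T p := by
  obtain ⟨p₁, p₂⟩ := p
  rw [mem_singletEllipse hd] at hp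
  simp only at hp
  have hd2 : (2 : ℝ) ≤ d := by exact_mod_cast hd
  have hd0 : (0 : ℝ) < d := by linarith
  obtain ⟨D, hD⟩ : ∃ D, D = (d : ℝ) ^ 2 - 1 := ⟨_, rfl⟩
  rw [← hD] at hp
  have hD0 : 0 < D := by nlinarith
  have hD1 : 0 < D - 1 := by nlinarith
  -- `μ = tr(JP)/d` is the weight on the range of `P`. Below, `A`, `B`, `C` solve the equations for
  -- `p₁`, `p₂` and `d A + d B + 2 C = μ`, and `g` spreads the rest over `1 - P`, which shifts both
  -- singlet fractions by `-(1 - μ)/D`.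
  obtain ⟨μ, rfl⟩ : ∃ μ, r = d * μ := ⟨r / d, by field_simp⟩
  have hμ0 : 0 ≤ μ := nonneg_of_mul_nonneg_right hr.1 hd0
  have hμ1 : μ ≤ 1 := by
    have := hr.2
    by_contra! h
    nlinarith
  obtain ⟨z, hz⟩ : ∃ z, z = D * (p₁ + p₂) - (d * μ * d - 2) := ⟨_, rfl⟩
  rw [← hz] at hp
  obtain ⟨C, hC⟩ : ∃ C, C = (z - μ) / (2 * D) := ⟨_, rfl⟩
  obtain ⟨A, hA⟩ : ∃ A, A = (p₁ - 2 * C + (1 - μ) / D) / d := ⟨_, rfl⟩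
  obtain ⟨B, hB⟩ : ∃ B, B = (p₂ - 2 * C + (1 - μ) / D) / d := ⟨_, rfl⟩
  obtain ⟨g, hg⟩ : ∃ g, g = (1 - μ) / (D - 1) := ⟨_, rfl⟩
  have hdd : (d : ℝ) ^ 2 = D + 1 := by linarith
  have hz' : z = D * (p₁ + p₂) - ((D + 1) * μ - 2) := by rw [hz, ← hdd]; ring
  have hg0 : 0 ≤ g := by rw [hg]; exact div_nonneg (by linarith) hD1.le
  have hCz : 2 * D * C = z - μ := by rw [hC]; field_simp
  have hAe : D * (d * A) = D * p₁ - (z - μ) + (1 - μ) := by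
    rw [← hCz, hA]; field_simp
  have hBe : D * (d * B) = D * p₂ - (z - μ) + (1 - μ) := by
    rw [← hCz, hB]; field_simp
  have hsum : D * (d * A + d * B) = (D + 1) * μ - z := by linear_combination hAe + hBe - hz'
  have hdiff : d * A - d * B = p₁ - p₂ := by rw [hA, hB]; field_simp; ring
  have hzle : z ≤ (D + 1) * μ := by
    have h1 : z ^ 2 ≤ (d * μ) ^ 2 := by nlinarith [mul_nonneg hD0.le (sq_nonneg (p₁ - p₂))]
    have h2 : z ≤ d * μ := le_of_abs_le (abs_le_of_sq_le_sq h1 (by positivity))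
    have h3 : d * μ ≤ (D + 1) * μ := mul_le_mul_of_nonneg_right (by nlinarith) hμ0
    linarith
  have hprod : C ^ 2 ≤ A * B := by
    -- Since `d² = D + 1`, this is `D` times the ellipse inequality, rearranged.
    have h1 : (d : ℝ) ^ 2 * (z - μ) ^ 2 + D ^ 2 * (p₁ - p₂) ^ 2 ≤ ((D + 1) * μ - z) ^ 2 := by
      rw [mul_pow] at hp
      rw [hdd] at hp ⊢
      nlinarith [mul_le_mul_of_nonneg_left hp hD0.le]
    have h2 : 4 * D ^ 2 * d ^ 2 * C ^ 2 ≤ 4 * D ^ 2 * d ^ 2 * (A * B) := by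
      calc 4 * D ^ 2 * d ^ 2 * C ^ 2 = (d : ℝ) ^ 2 * (z - μ) ^ 2 := by rw [← hCz]; ring
        _ ≤ ((D + 1) * μ - z) ^ 2 - D ^ 2 * (p₁ - p₂) ^ 2 := by linarith
        _ = 4 * D ^ 2 * d ^ 2 * (A * B) := by rw [← hsum, ← hdiff]; ring
    exact le_of_mul_le_mul_left h2 (by positivity)
  have hAB : 0 ≤ A + B := by
    have h1 : 0 ≤ D * d * (A + B) := by linarith
    exact nonneg_of_mul_nonneg_right h1 (by positivity)
  have hA0 : 0 ≤ A := by nlinarith [sq_nonneg C]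
  have hB0 : 0 ≤ B := by nlinarith [sq_nonneg C]
  have hJ := ((one_sub_pairProj_posSemidef hd).smul (a := (g : ℂ)) (by exact_mod_cast hg0)).add
    (pair_combination_posSemidef (d := d) hA0 hB0 hprod)
  have hDc : (D : ℂ) = (d : ℂ) ^ 2 - 1 := by rw [hD]; push_cast; rfl
  have hJe : (g : ℂ) • (1 - pairProj d) + ((A : ℂ) • pairOp d 0 0 + (B : ℂ) • pairOp d 1 1
      + (C : ℂ) • pairOp d 0 1 + (C : ℂ) • pairOp d 1 0)
      = (g : ℂ) • 1 + ((A - g * d / D : ℝ) : ℂ) • pairOp d 0 0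
        + ((B - g * d / D : ℝ) : ℂ) • pairOp d 1 1
        + ((C + g / D : ℝ) : ℂ) • pairOp d 0 1 + ((C + g / D : ℝ) : ℂ) • pairOp d 1 0 := by
    rw [pairProj, ← hDc]
    push_cast
    match_scalars <;> field_simp <;> ring
  rw [hJe] at hJ
  have hgD : g * (D - 1) = 1 - μ := by rw [hg]; field_simp
  have hdA : d * A = p₁ - 2 * C + (1 - μ) / D := by rw [hA]; field_simp
  have hdB : d * B = p₂ - 2 * C + (1 - μ) / D := by rw [hB]; field_simp
  have hcl := isUniversalCloner_ofChoi (by omega : d ≠ 0) hJ (by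
    have h1 : d * A + d * B + 2 * C = μ := by
      have : D * (d * A + d * B + 2 * C) = D * μ := by linear_combination hsum + hCz
      exact mul_left_cancel₀ hD0.ne' this
    have h2 : g * d ^ 2 + d * (A - g * d / D) + d * (B - g * d / D) + 2 * (C + g / D)
        = (d * A + d * B + 2 * C) + g * (d ^ 2 - 2 * d ^ 2 / D + 2 / D) := by ring
    have h3 : (d : ℝ) ^ 2 - 2 * d ^ 2 / D + 2 / D = D - 1 := by
      rw [hdd]; field_simp; ring
    rw [h2, h1, h3, hgD]; ring)
  have e1 : d * (A - g * d / D) + 2 * (C + g / D) = p₁ := by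
    have : d * (A - g * d / D) + 2 * (C + g / D) = d * A + 2 * C - g * (d ^ 2 - 2) / D := by ring
    rw [this, hdA, show (d : ℝ) ^ 2 - 2 = D - 1 by linarith, hgD]; ring
  have e2 : d * (B - g * d / D) + 2 * (C + g / D) = p₂ := by
    have : d * (B - g * d / D) + 2 * (C + g / D) = d * B + 2 * C - g * (d ^ 2 - 2) / D := by ring
    rw [this, hdB, show (d : ℝ) ^ 2 - 2 = D - 1 by linarith, hgD]; ring
  rw [e1, e2] at hcl
  exact ⟨_, hcl⟩

/-! ### Singlet fractions of arbitrary and universal channels -/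

/-- The pair `((F₁ - 1) / (d² - 1), (F₂ - 1) / (d² - 1))`, where `F_i` is the entanglement fidelity
of the `i`-th marginal of `T`; these are the singlet fractions if `T` is universal. -/
def meanSingletFractions (T : Mat (Fin d) →ₗ[ℂ] Mat (Fin d × Fin d)) : ℝ × ℝ :=
  ((entanglementFidelity (traceSecondL d ∘ₗ T) - 1) / ((d : ℝ) ^ 2 - 1),
    (entanglementFidelity (traceFirstL d ∘ₗ T) - 1) / ((d : ℝ) ^ 2 - 1))

lemma sq_sub_one_pos (hd : 2 ≤ d) : (0 : ℝ) < (d : ℝ) ^ 2 - 1 := by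
  have : (2 : ℝ) ≤ d := by exact_mod_cast hd
  nlinarith

/-- The index is `r = tr(JP)`. With it, the scaled offset from the centre is the expectation of
`pairSym`, and `F₁ - F₂` is that of `pairDiff`. -/
lemma meanSingletFractions_mem (hd : 2 ≤ d) {T : Mat (Fin d) →ₗ[ℂ] Mat (Fin d × Fin d)}
    (hT : IsChannel T) :
    ∃ r ∈ Set.Icc (0 : ℝ) d, meanSingletFractions T ∈ singletEllipse d r := by
  have hD := sq_sub_one_pos hd
  have hJ := choi_posSemidef hT.1
  have hle := expect_pairProj_le hd hJ
  rw [choi_trace T hT.2, Complex.natCast_re] at hle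
  refine ⟨expect (choi T) (pairProj d), ⟨expect_pairProj_nonneg hd hJ, hle⟩, ?_⟩
  have h := expect_pair_bound hd hJ
  rw [mem_singletEllipse hd]
  convert h using 1
  have hsmul := expect_smul (choi T) (pairProj d) (d : ℝ)
  rw [Complex.ofReal_natCast] at hsmul
  rw [pairSym, pairDiff, expect_sub, expect_sub, expect_add, hsmul, expect_choi_zero,
    expect_choi_one]
  simp only [meanSingletFractions]
  field_simp
  ring

lemma IsCompletelyPositive.posSemidef {m n : Type}
    {T : Mat m →ₗ[ℂ] Mat n} (hT : IsCompletelyPositive T) {X : Mat m} (hX : X.PosSemidef) :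
    (T X).PosSemidef :=
  (hT 1 (X.submatrix Prod.snd Prod.snd) (hX.submatrix _)).submatrix fun x : n => ((0 : Fin 1), x)

lemma traceSecond_posSemidef {X : Mat (Fin d × Fin d)} (hX : X.PosSemidef) :
    (traceSecond X).PosSemidef := by
  have h : traceSecond X = ∑ k, X.submatrix (fun i => (i, k)) (fun i => (i, k)) := by
    ext i j
    simp [traceSecond, Matrix.sum_apply]
  rw [h]
  exact Matrix.posSemidef_sum _ fun k _ => hX.submatrix _

lemma traceFirst_posSemidef {X : Mat (Fin d × Fin d)} (hX : X.PosSemidef) :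
    (traceFirst X).PosSemidef := by
  have h : traceFirst X = ∑ k, X.submatrix (fun i => (k, i)) (fun i => (k, i)) := by
    ext i j
    simp [traceFirst, Matrix.sum_apply]
  rw [h]
  exact Matrix.posSemidef_sum _ fun k _ => hX.submatrix _

lemma UnitVector.proj_isState (ψ : UnitVector d) : IsState ψ.proj :=
  ⟨Matrix.posSemidef_vecMulVec_self_star _, by
    rw [UnitVector.proj, Matrix.trace_vecMulVec, dotProduct_comm]; exact ψ.2⟩

lemma fidelity_nonneg {σ : Mat (Fin d)} (hσ : σ.PosSemidef) (ψ : UnitVector d) :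
    0 ≤ fidelity σ ψ :=
  (Complex.le_def.1 (hσ.dotProduct_mulVec_nonneg ψ.1)).1

lemma fidelity_depolarized (hd : d ≠ 0) (p : ℝ) (ψ : UnitVector d) :
    fidelity ((p : ℂ) • ψ.proj + ((1 - p : ℂ) / d) • (1 : Mat (Fin d))) ψ
      = ((d - 1) * p + 1) / d := by
  have hd' : (d : ℝ) ≠ 0 := by exact_mod_cast hd
  have h : star ψ.1 ⬝ᵥ (((p : ℂ) • ψ.proj + ((1 - p : ℂ) / d) • (1 : Mat (Fin d))) *ᵥ ψ.1)
      = ((p + (1 - p) / d : ℝ) : ℂ) := by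
    rw [Matrix.add_mulVec, Matrix.smul_mulVec, Matrix.smul_mulVec, Matrix.one_mulVec,
      UnitVector.proj, Matrix.vecMulVec_mulVec, dotProduct_add, dotProduct_smul, dotProduct_smul]
    simp [ψ.2]
  rw [fidelity, h, Complex.ofReal_re]
  field_simp
  ring

lemma IsUniversalCloner.fidelity_eq (hd : d ≠ 0) {T : Mat (Fin d) →ₗ[ℂ] Mat (Fin d × Fin d)}
    {p : ℝ × ℝ} (hT : IsUniversalCloner T p) (ψ : UnitVector d) :
    fidelity (traceSecond (T ψ.proj)) ψ = ((d - 1) * p.1 + 1) / d ∧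
    fidelity (traceFirst (T ψ.proj)) ψ = ((d - 1) * p.2 + 1) / d := by
  obtain ⟨h1, h2⟩ := hT.2 _ ψ.proj_isState
  rw [h1, h2]
  exact ⟨fidelity_depolarized hd _ _, fidelity_depolarized hd _ _⟩

lemma trace_traceSecondL {T : Mat (Fin d) →ₗ[ℂ] Mat (Fin d × Fin d)} (hT : IsChannel T)
    (X : Mat (Fin d)) : ((traceSecondL d ∘ₗ T) X).trace = X.trace :=
  (traceSecond_trace _).trans (hT.2 X)

lemma trace_traceFirstL {T : Mat (Fin d) →ₗ[ℂ] Mat (Fin d × Fin d)} (hT : IsChannel T)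
    (X : Mat (Fin d)) : ((traceFirstL d ∘ₗ T) X).trace = X.trace :=
  (traceFirst_trace _).trans (hT.2 X)

/-- The fidelities do not depend on the pure state, so the averaging formula gives the entanglement
fidelities exactly. -/
lemma IsUniversalCloner.meanSingletFractions_eq (hd : 2 ≤ d)
    {T : Mat (Fin d) →ₗ[ℂ] Mat (Fin d × Fin d)} {p : ℝ × ℝ} (hT : IsUniversalCloner T p) :
    meanSingletFractions T = p := by
  have hd0 : d ≠ 0 := by omega
  have : NeZero d := ⟨hd0⟩
  have hdr : (d : ℝ) ≠ 0 := by exact_mod_cast hd0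
  have hD := (sq_sub_one_pos hd).ne'
  have h1 := entanglementFidelity_of_fidelity_eq _ (trace_traceSecondL hT.1)
    fun ψ => (hT.fidelity_eq hd0 ψ).1
  have h2 := entanglementFidelity_of_fidelity_eq _ (trace_traceFirstL hT.1)
    fun ψ => (hT.fidelity_eq hd0 ψ).2
  rw [meanSingletFractions, h1, h2]
  ext
  · simp only; field_simp; ring
  · simp only; field_simp; ring

lemma IsUniversalCloner.exists_mem_singletEllipse (hd : 2 ≤ d)
    {T : Mat (Fin d) →ₗ[ℂ] Mat (Fin d × Fin d)} {p : ℝ × ℝ} (hT : IsUniversalCloner T p) :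
    ∃ r ∈ Set.Icc (0 : ℝ) d, p ∈ singletEllipse d r := by
  simpa only [hT.meanSingletFractions_eq hd] using meanSingletFractions_mem hd hT.1

/-! ### Weighted fidelities, support functions and optimality -/

/-- The weighted fidelity of a universal cloner with singlet fractions `p`. -/
def weightedFidelity (d : ℕ) (w p : ℝ × ℝ) : ℝ :=
  w.1 * (((d - 1) * p.1 + 1) / d) + w.2 * (((d - 1) * p.2 + 1) / d)

lemma weightedFidelity_le_iff (hd : 2 ≤ d) (w p q : ℝ × ℝ) :
    weightedFidelity d w p ≤ weightedFidelity d w q ↔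
      w.1 * p.1 + w.2 * p.2 ≤ w.1 * q.1 + w.2 * q.2 := by
  have hd2 : (2 : ℝ) ≤ d := by exact_mod_cast hd
  have h : ∀ x : ℝ × ℝ, weightedFidelity d w x
      = (d - 1) / d * (w.1 * x.1 + w.2 * x.2) + (w.1 + w.2) / d := by
    intro x; rw [weightedFidelity]; ring
  have hpos : (0 : ℝ) < (d - 1) / d := div_pos (by linarith) (by linarith)
  rw [h, h, add_le_add_iff_right, mul_le_mul_iff_right₀ hpos]

lemma IsUniversalCloner.worstFidelity_eq (hd : 2 ≤ d)
    {T : Mat (Fin d) →ₗ[ℂ] Mat (Fin d × Fin d)} {p : ℝ × ℝ} (hT : IsUniversalCloner T p)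
    (w : ℝ × ℝ) : worstFidelity w T = weightedFidelity d w p := by
  have hd0 : d ≠ 0 := by omega
  have : Nonempty (UnitVector d) := ⟨basisVector ⟨0, by omega⟩⟩
  simp only [worstFidelity, (hT.fidelity_eq hd0 _).1, (hT.fidelity_eq hd0 _).2, ciInf_const,
    weightedFidelity]

lemma worstFidelity_le (hd : 2 ≤ d) {T : Mat (Fin d) →ₗ[ℂ] Mat (Fin d × Fin d)}
    (hT : IsChannel T) {w : ℝ × ℝ} (hw1 : 0 ≤ w.1) (hw2 : 0 ≤ w.2) :
    worstFidelity w T ≤ weightedFidelity d w (meanSingletFractions T) := by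
  have hd0 : d ≠ 0 := by omega
  have : NeZero d := ⟨hd0⟩
  have hdr : (0 : ℝ) < d := by exact_mod_cast hd0.bot_lt
  have hD := sq_sub_one_pos hd
  have key : ∀ {c F : ℝ}, ((d : ℝ) ^ 2 + d) * c ≤ F + d →
      c ≤ ((d - 1) * ((F - 1) / ((d : ℝ) ^ 2 - 1)) + 1) / d := by
    intro c F h
    have hd1 : (0 : ℝ) < d - 1 := by nlinarith
    have e : ((d - 1) * ((F - 1) / ((d : ℝ) ^ 2 - 1)) + 1) / d = (F + d) / ((d : ℝ) ^ 2 + d) := by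
      rw [show (d : ℝ) ^ 2 - 1 = (d - 1) * (d + 1) by ring]
      field_simp
      ring
    rw [e, le_div_iff₀ (by positivity)]
    linarith
  refine add_le_add (mul_le_mul_of_nonneg_left (key ?_) hw1)
    (mul_le_mul_of_nonneg_left (key ?_) hw2)
  · refine le_entanglementFidelity _ (trace_traceSecondL hT) fun ψ => ciInf_le ⟨0, ?_⟩ ψ
    rintro _ ⟨φ, rfl⟩
    exact fidelity_nonneg (traceSecond_posSemidef (hT.1.posSemidef φ.proj_isState.1)) φ
  · refine le_entanglementFidelity _ (trace_traceFirstL hT) fun ψ => ciInf_le ⟨0, ?_⟩ ψ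
    rintro _ ⟨φ, rfl⟩
    exact fidelity_nonneg (traceFirst_posSemidef (hT.1.posSemidef φ.proj_isState.1)) φ

/-- The support function of the ellipse of index `r`, in the direction of the weights `w` and up to
the factor `d² - 1`. -/
def ellipseSupport (d : ℕ) (w : ℝ × ℝ) (r : ℝ) : ℝ :=
  (w.1 + w.2) / 2 * (r * d - 2)
    + r * √(((w.1 + w.2) / 2) ^ 2 + ((d : ℝ) ^ 2 - 1) * ((w.1 - w.2) / 2) ^ 2)

/-- Cauchy–Schwarz for the form `z² + D t²`, where `z` is the scaled offset of `p₁ + p₂` from the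
centre and `t = p₁ - p₂`. -/
lemma le_ellipseSupport (hd : 2 ≤ d) (w : ℝ × ℝ) {r : ℝ} (hr : 0 ≤ r) {p : ℝ × ℝ}
    (hp : p ∈ singletEllipse d r) :
    ((d : ℝ) ^ 2 - 1) * (w.1 * p.1 + w.2 * p.2) ≤ ellipseSupport d w r := by
  have hD := sq_sub_one_pos hd
  rw [mem_singletEllipse hd] at hp
  rw [ellipseSupport]
  generalize (d : ℝ) ^ 2 - 1 = D at *
  set u := (w.1 + w.2) / 2 with hu
  set v := (w.1 - w.2) / 2 with hv
  set t := p.1 - p.2 with ht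
  set z := D * (p.1 + p.2) - (r * d - 2) with hz
  have e : D * (w.1 * p.1 + w.2 * p.2) = u * (r * d - 2) + (u * z + D * v * t) := by
    rw [hu, hv, ht, hz]; ring
  rw [e, add_le_add_iff_left]
  have hS : 0 ≤ u ^ 2 + D * v ^ 2 := by positivity
  refine le_of_abs_le (abs_le_of_sq_le_sq ?_ (by positivity))
  rw [mul_pow, Real.sq_sqrt hS]
  calc (u * z + D * v * t) ^ 2
      = (D * t ^ 2 + z ^ 2) * (u ^ 2 + D * v ^ 2) - D * (u * t - v * z) ^ 2 := by ring
    _ ≤ (D * t ^ 2 + z ^ 2) * (u ^ 2 + D * v ^ 2) := by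
        have : 0 ≤ D * (u * t - v * z) ^ 2 := by positivity
        linarith
    _ ≤ r ^ 2 * (u ^ 2 + D * v ^ 2) := mul_le_mul_of_nonneg_right hp hS

lemma exists_eq_ellipseSupport (hd : 2 ≤ d) {w : ℝ × ℝ} (hw : 0 < w.1 + w.2) (r : ℝ) :
    ∃ p ∈ singletEllipse d r,
      ((d : ℝ) ^ 2 - 1) * (w.1 * p.1 + w.2 * p.2) = ellipseSupport d w r := by
  have hD := sq_sub_one_pos hd
  simp only [mem_singletEllipse hd, ellipseSupport]
  generalize (d : ℝ) ^ 2 - 1 = D at *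
  obtain ⟨u, hu⟩ : ∃ u, u = (w.1 + w.2) / 2 := ⟨_, rfl⟩
  obtain ⟨v, hv⟩ : ∃ v, v = (w.1 - w.2) / 2 := ⟨_, rfl⟩
  have hw1 : w.1 = u + v := by linarith
  have hw2 : w.2 = u - v := by linarith
  have hu0 : 0 < u := by linarith
  rw [← hu, ← hv, hw1, hw2]
  have hS : 0 < u ^ 2 + D * v ^ 2 := by positivity
  obtain ⟨K, hK⟩ : ∃ K, K = √(u ^ 2 + D * v ^ 2) := ⟨_, rfl⟩
  have hK0 : 0 < K := by rw [hK]; exact Real.sqrt_pos.2 hS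
  have hK2 : K ^ 2 = u ^ 2 + D * v ^ 2 := by rw [hK, Real.sq_sqrt hS.le]
  rw [← hK]
  -- The equality case of Cauchy–Schwarz: `(z, t) = (r / K) (u, v)`.
  refine ⟨(((r * d - 2 + r * u / K) / D + r * v / K) / 2,
    ((r * d - 2 + r * u / K) / D - r * v / K) / 2), ?_, ?_⟩
  · apply le_of_eq
    field_simp
    linear_combination (-4 * r ^ 2 * D) * hK2
  · field_simp
    linear_combination (-2 * r) * hK2

/-- The centre moves strictly in a direction favoured by `w` as the ellipse grows; this singles out
`λ = d`. -/
lemma ellipseSupport_lt (hd : 2 ≤ d) {w : ℝ × ℝ} (hw : 0 < w.1 + w.2) {r s : ℝ} (h : r < s) :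
    ellipseSupport d w r < ellipseSupport d w s := by
  have hd2 : (2 : ℝ) ≤ d := by exact_mod_cast hd
  rw [ellipseSupport, ellipseSupport]
  refine add_lt_add_of_lt_of_le ?_ (mul_le_mul_of_nonneg_right h.le (Real.sqrt_nonneg _))
  refine mul_lt_mul_of_pos_left ?_ (by linarith)
  nlinarith

/-- Optimality of a universal cloner: its weighted singlet fraction is extremal. -/
lemma IsUniversalCloner.isOptimalCloner_iff (hd : 2 ≤ d) {w : ℝ × ℝ} (hw1 : 0 ≤ w.1)
    (hw2 : 0 ≤ w.2) (hw : 0 < w.1 + w.2) {T : Mat (Fin d) →ₗ[ℂ] Mat (Fin d × Fin d)}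
    {p : ℝ × ℝ} (hT : IsUniversalCloner T p) :
    IsOptimalCloner w T ↔
      ellipseSupport d w d ≤ ((d : ℝ) ^ 2 - 1) * (w.1 * p.1 + w.2 * p.2) := by
  have hD := sq_sub_one_pos hd
  constructor
  · rintro ⟨-, h⟩
    obtain ⟨q, hq, hqe⟩ := exists_eq_ellipseSupport hd hw (d : ℝ)
    obtain ⟨S, hS⟩ := exists_isUniversalCloner hd ⟨Nat.cast_nonneg d, le_rfl⟩ hq
    have := h S hS.1
    rw [hS.worstFidelity_eq hd, hT.worstFidelity_eq hd, weightedFidelity_le_iff hd] at this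
    rw [← hqe]
    exact mul_le_mul_of_nonneg_left this hD.le
  · refine fun h => ⟨hT.1, fun S hS => (worstFidelity_le hd hS hw1 hw2).trans ?_⟩
    rw [hT.worstFidelity_eq hd, weightedFidelity_le_iff hd]
    obtain ⟨r, hr, hmem⟩ := meanSingletFractions_mem hd hS
    refine le_of_mul_le_mul_left (((le_ellipseSupport hd w hr.1 hmem).trans ?_).trans h) hD
    rcases hr.2.eq_or_lt with rfl | hlt
    · exact le_rfl
    · exact (ellipseSupport_lt hd hw hlt).le

lemma eq_of_ellipseSupport_le (hd : 2 ≤ d) {w : ℝ × ℝ} (hw : 0 < w.1 + w.2) {p : ℝ × ℝ}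
    (h : ellipseSupport d w d ≤ ((d : ℝ) ^ 2 - 1) * (w.1 * p.1 + w.2 * p.2)) {r : ℝ}
    (hr : r ∈ Set.Icc (0 : ℝ) d) (hp : p ∈ singletEllipse d r) : r = d := by
  by_contra hne
  have h1 := ellipseSupport_lt hd hw (lt_of_le_of_ne hr.2 hne)
  have h2 := le_ellipseSupport hd w hr.1 hp
  linarith

/-! ### The achievable sets -/

lemma mem_fidelityEllipse {r : ℝ} {f : ℝ × ℝ} :
    f ∈ fidelityEllipse d r ↔
      ((d * f.1 - 1) / ((d : ℝ) - 1), (d * f.2 - 1) / ((d : ℝ) - 1)) ∈ singletEllipse d r := by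
  have e1 : (d * f.1 - 1) / ((d : ℝ) - 1) + (d * f.2 - 1) / ((d : ℝ) - 1)
      = (d * (f.1 + f.2) - 2) / ((d : ℝ) - 1) := by ring
  have e2 : (d * f.1 - 1) / ((d : ℝ) - 1) - (d * f.2 - 1) / ((d : ℝ) - 1)
      = d * (f.1 - f.2) / ((d : ℝ) - 1) := by ring
  simp only [fidelityEllipse, singletEllipse, Set.mem_ofPred_eq, e1, e2]

lemma achievableSingletFractions_eq (hd : 2 ≤ d) :
    achievableSingletFractions d = ⋃ r ∈ Set.Icc (0 : ℝ) d, singletEllipse d r := by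
  ext p
  simp only [Set.mem_iUnion₂, exists_prop]
  exact ⟨fun ⟨_, hT⟩ => hT.exists_mem_singletEllipse hd,
    fun ⟨_, hr, hp⟩ => exists_isUniversalCloner hd hr hp⟩

lemma achievableFidelities_eq (hd : 2 ≤ d) :
    achievableFidelities d = ⋃ r ∈ Set.Icc (0 : ℝ) d, fidelityEllipse d r := by
  have hd0 : d ≠ 0 := by omega
  have hd2 : (2 : ℝ) ≤ d := by exact_mod_cast hd
  have hdr : (d : ℝ) ≠ 0 := by linarith
  have hd1 : (d : ℝ) - 1 ≠ 0 := by linarith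
  ext f
  simp only [Set.mem_iUnion₂, exists_prop, mem_fidelityEllipse]
  constructor
  · rintro ⟨T, p, hT, hf⟩
    let ψ : UnitVector d := basisVector ⟨0, by omega⟩
    have h1 := (hf ψ).1.symm.trans (hT.fidelity_eq hd0 ψ).1
    have h2 := (hf ψ).2.symm.trans (hT.fidelity_eq hd0 ψ).2
    have e : ((d * f.1 - 1) / ((d : ℝ) - 1), (d * f.2 - 1) / ((d : ℝ) - 1)) = p := by
      rw [h1, h2]
      ext <;> field_simp <;> ring
    rw [e]
    exact hT.exists_mem_singletEllipse hd
  · rintro ⟨r, hr, hp⟩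
    obtain ⟨T, hT⟩ := exists_isUniversalCloner hd hr hp
    refine ⟨T, _, hT, fun ψ => ?_⟩
    obtain ⟨h1, h2⟩ := hT.fidelity_eq hd0 ψ
    rw [h1, h2]
    constructor <;> field_simp <;> ring

end

end Cloning

theorem mainTheorem1 (d : ℕ) (hd : 2 ≤ d) :
    -- the achievable singlet fractions are the union of the ellipses
    Cloning.achievableSingletFractions d
        = ⋃ r ∈ Set.Icc (0 : ℝ) d, Cloning.singletEllipse d r ∧
    -- the same for the fidelities
    Cloning.achievableFidelities d
        = ⋃ r ∈ Set.Icc (0 : ℝ) d, Cloning.fidelityEllipse d r ∧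
    -- the optimal cloners correspond to the ellipse of index `d`
    (∀ w : ℝ × ℝ, w.1 ∈ Set.Icc (0 : ℝ) 1 → w.2 ∈ Set.Icc (0 : ℝ) 1 → w ≠ 0 →
      (∃ (T : Cloning.Mat (Fin d) →ₗ[ℂ] Cloning.Mat (Fin d × Fin d)) (p : ℝ × ℝ),
        Cloning.IsUniversalCloner T p ∧ Cloning.IsOptimalCloner w T) ∧
      ∀ (T : Cloning.Mat (Fin d) →ₗ[ℂ] Cloning.Mat (Fin d × Fin d)) (p : ℝ × ℝ),
        Cloning.IsUniversalCloner T p →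
        (Cloning.IsOptimalCloner w T ↔
          p ∈ Cloning.singletEllipse d d ∧
          ∀ q ∈ Cloning.singletEllipse d d, w.1 * q.1 + w.2 * q.2 ≤ w.1 * p.1 + w.2 * p.2) ∧
        (Cloning.IsOptimalCloner w T →
          ∀ r ∈ Set.Icc (0 : ℝ) d, p ∈ Cloning.singletEllipse d r → r = d)) := by
  refine ⟨Cloning.achievableSingletFractions_eq hd, Cloning.achievableFidelities_eq hd, ?_⟩
  rintro w ⟨hw1, -⟩ ⟨hw2, -⟩ hw0
  have hw : 0 < w.1 + w.2 := by
    refine (add_nonneg hw1 hw2).lt_of_ne fun h => hw0 (Prod.ext ?_ ?_)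
    · simp only [Prod.fst_zero]; linarith
    · simp only [Prod.snd_zero]; linarith
  have hD := Cloning.sq_sub_one_pos hd
  obtain ⟨q, hq, hqe⟩ := Cloning.exists_eq_ellipseSupport hd hw (d : ℝ)
  refine ⟨?_, fun T p hT => ?_⟩
  · obtain ⟨T, hT⟩ := Cloning.exists_isUniversalCloner hd ⟨Nat.cast_nonneg d, le_rfl⟩ hq
    exact ⟨T, q, hT, (hT.isOptimalCloner_iff hd hw1 hw2 hw).2 hqe.ge⟩
  · rw [hT.isOptimalCloner_iff hd hw1 hw2 hw]
    refine ⟨⟨fun h => ⟨?_, fun x hx => ?_⟩, fun h => ?_⟩,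
      fun h r hr hp => Cloning.eq_of_ellipseSupport_le hd hw h hr hp⟩
    · obtain ⟨r, hr, hp⟩ := hT.exists_mem_singletEllipse hd
      rwa [Cloning.eq_of_ellipseSupport_le hd hw h hr hp] at hp
    · exact le_of_mul_le_mul_left
        ((Cloning.le_ellipseSupport hd w (Nat.cast_nonneg d) hx).trans h) hD
    · rw [← hqe]
      exact mul_le_mul_of_nonneg_left (h.2 q hq) hD.le
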